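/- Let $(\rho_k)_{k\ge 1}$ be a sequence of real numbers. It is called an expected ranges sequence (ERS) of an integrable real random variable $X$ if $\rho_k=\mathbb{E}\big[\max_{1\le i\le k}X_i-\min_{1\le i\le k}X_i\big]$ for all $k\ge 1$, where $X_1,\dots,X_k$ are independent copies of $X$; $X$ is non-degenerate if it is not almost surely constant. For a function $g:[1,\infty)\to\mathbb{R}$, a finite positive Borel measure $\mu$ on $(0,\infty)$ and measurable functions $h,s:(0,\infty)\to\mathbb{R}$ with $h\ge 0$, write $g=G_s(h;\mu)$ if $$\int_{(0,\infty)}h(y)e^{-y}(1-e^{-y})\,d\mu(y)<\infty\quad\text{and}\quad g(x)=\int_{(0,\infty)}h(y)\big(s(y)-e^{-xy}\big)\,d\mu(y)\ \text{ for all }x\ge 1,$$ the last integrals being absolutely convergent. Let $\mathcal{G}^*$ be the class of all nonconstant functions $g:[1,\infty)\to\mathbb{R}$ of this form, and write $g=G_s(\mu)$ (canonical form, with canonical measure $\mu$) if $g=G_s(h_0;\mu)$ with $h_0(y)=e^{y}/(1-e^{-y})$. **Corollary 4.1.** The sequence $(\rho_k)_{k\ge1}$ is an ERS of a non-degenerate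 integrable random variable if and only if $\rho_1=0$ and there is a function $g=G_s(\mu)\in\mathcal{G}^*$ with $g(k)=\rho_k$ for all $k\ge 1$ whose measure $\mu$ satisfies $$\mu\big((0,y]\big)=\mu\big([-\log(1-e^{-y}),\infty)\big),\qquad 0<y<\infty.\tag{4.3}$$ Moreover, if $(\rho_k)$ is an ERS of a non-degenerate integrable random variable, then for every $g\in\mathcal{G}^*$ with $g(k)=\rho_k$ for all $k\ge1$, every measure $\mu$ in a canonical form $g=G_s(\mu)$ satisfies (4.3). -/

import Mathlib

open MeasureTheory Set

noncomputable section

/-- The expected range `E R_k(X)` of `k` independent copies of the random variable `X` on `(Ω, P)`.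
The copies are realized on the product space `(Ω ^ k, P ^ k)` as `ω ↦ X (ω i)`, `i < k`. -/
def expectedRange {Ω : Type} [MeasurableSpace Ω] (P : Measure Ω) (X : Ω → ℝ) (k : ℕ) : ℝ :=
  ∫ ω : Fin k → Ω, ((⨆ i, X (ω i)) - ⨅ i, X (ω i)) ∂(Measure.pi fun _ : Fin k => P)

/-- `X` is not almost surely equal to a constant. -/
def NonDegenerate {Ω : Type} [MeasurableSpace Ω] (P : Measure Ω) (X : Ω → ℝ) : Prop :=
  ¬ ∃ c : ℝ, ∀ᵐ ω ∂P, X ω = c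

/-- The sequence `ρ 1, ρ 2, …` is the expected ranges sequence of some non-degenerate integrable
real random variable. The value `ρ 0` plays no role. -/
def IsERSOfNonDegenerate (ρ : ℕ → ℝ) : Prop :=
  ∃ (Ω : Type) (_ : MeasurableSpace Ω) (P : Measure Ω) (X : Ω → ℝ),
    IsProbabilityMeasure P ∧ Measurable X ∧ Integrable X P ∧ NonDegenerate P X ∧
      ∀ k : ℕ, 1 ≤ k → expectedRange P X k = ρ k

/-- `g = G_s(h; μ)`: here `μ` is a finite positive measure on `(0, ∞)` (a measure on `ℝ` giving no
mass to `(-∞, 0]`), `h ≥ 0` and `s` are measurable,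
`∫_{(0,∞)} h(y) e^{-y} (1 - e^{-y}) dμ(y) < ∞`, and, for every `x ≥ 1`,
`g(x) = ∫_{(0,∞)} h(y) (s(y) - e^{-xy}) dμ(y)` as a convergent integral. -/
structure IsGIF (s h : ℝ → ℝ) (μ : Measure ℝ) (g : Ici (1 : ℝ) → ℝ) : Prop where
  finite : IsFiniteMeasure μ
  support : μ (Iic 0) = 0
  measurable_s : Measurable s
  measurable_h : Measurable h
  nonneg : ∀ y : ℝ, 0 < y → 0 ≤ h y
  integrable : IntegrableOn (fun y => h y * (Real.exp (-y) * (1 - Real.exp (-y)))) (Ioi 0) μ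
  integrable_kernel : ∀ x : Ici (1 : ℝ),
    IntegrableOn (fun y => h y * (s y - Real.exp (-((x : ℝ) * y)))) (Ioi 0) μ
  eq_integral : ∀ x : Ici (1 : ℝ),
    g x = ∫ y in Ioi (0 : ℝ), h y * (s y - Real.exp (-((x : ℝ) * y))) ∂μ

/-- The class `𝒢*` of the nonconstant functions on `[1, ∞)` that admit a generalized integral
form. -/
def GStar : Set (Ici (1 : ℝ) → ℝ) :=
  {g | (∃ (s h : ℝ → ℝ) (μ : Measure ℝ), IsGIF s h μ g) ∧ ∃ x₁ x₂, g x₁ ≠ g x₂}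

/-- `h₀(y) = e^y / (1 - e^{-y})`, for `y > 0`. -/
def canonicalH (y : ℝ) : ℝ := Real.exp y / (1 - Real.exp (-y))

/-- `g = G_s(μ) = G_s(h₀; μ)`: the canonical form. -/
def IsCanonicalForm (s : ℝ → ℝ) (μ : Measure ℝ) (g : Ici (1 : ℝ) → ℝ) : Prop :=
  IsGIF s canonicalH μ g

/-- `g` restricted to the positive integers is the sequence `ρ`. -/
def Extends (g : Ici (1 : ℝ) → ℝ) (ρ : ℕ → ℝ) : Prop :=
  ∀ (k : ℕ) (hk : 1 ≤ k), g ⟨(k : ℝ), mem_Ici.2 (Nat.one_le_cast.2 hk)⟩ = ρ k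

/-- `μ((0, y]) = μ([-log(1 - e^{-y}), ∞))` for all `0 < y < ∞`. -/
def SymmetryCondition (μ : Measure ℝ) : Prop :=
  ∀ y : ℝ, 0 < y → μ (Ioc 0 y) = μ (Ici (-Real.log (1 - Real.exp (-y))))

end

/-! Substitute `u = e^{-y}` and let `M` be the image of `μ`, a finite measure on `(0, 1)`. The
weight `h₀` is `1 / (u (1 - u))`, so the centering `s` drops out of differences and `g (k + 2) - g
(k + 1) = ∫ u ^ k dM` (`IsCanonicalForm.moment_eq`). Condition (4.3) says that `M` is invariant
under `u ↦ 1 - u` (`symmetryCondition_iff`). The claim becomes: `ρ` is an ERS iff `ρ 1 = 0` and its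
differences are the moments of a nonzero symmetric `M`.

For an ERS, `E R_k = ∫ (1 - F ^ k - (1 - F) ^ k) dx` by Tonelli, `F` being the distribution
function. Consecutive differences are `∫ (F ^ k + (1 - F) ^ k) F (1 - F) dx`, the moments of the sum
of the images of `F (1 - F) dx` under `F` and `1 - F`; this sum is visibly symmetric. Moments
determine a finite measure on `(0, 1)` (`measure_ext_of_moments`), so every canonical measure
inherits the symmetry.

Conversely, given a symmetric `M`, the function with increments `M(du) / (2 u (1 - u))`, evaluated
at a uniform variable, has the required expected ranges. -/

/-! ### Moment determinacy on the unit interval -/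

theorem integrable_of_continuous_of_ae_mem_Ioo {M : Measure ℝ} [IsFiniteMeasure M]
    (hM : ∀ᵐ x ∂M, x ∈ Ioo (0 : ℝ) 1) {φ : ℝ → ℝ} (hφ : Continuous φ) : Integrable φ M := by
  have h : M.restrict (Icc 0 1) = M :=
    Measure.restrict_eq_self_of_ae_mem (hM.mono fun x hx => Ioo_subset_Icc_self hx)
  rw [← h]
  exact hφ.continuousOn.integrableOn_compact isCompact_Icc

/-- A finite measure on the unit interval is determined by its moments. -/
theorem measure_ext_of_moments {M N : Measure ℝ} [IsFiniteMeasure M] [IsFiniteMeasure N]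
    (hM : ∀ᵐ x ∂M, x ∈ Ioo (0 : ℝ) 1) (hN : ∀ᵐ x ∂N, x ∈ Ioo (0 : ℝ) 1)
    (h : ∀ k : ℕ, ∫ x, x ^ k ∂M = ∫ x, x ^ k ∂N) : M = N := by
  have hpoly : ∀ p : Polynomial ℝ, ∫ x, p.eval x ∂M = ∫ x, p.eval x ∂N := by
    intro p
    simp_rw [Polynomial.eval_eq_sum_range]
    rw [integral_finsetSum _ fun i _ => integrable_of_continuous_of_ae_mem_Ioo hM (by fun_prop),
      integral_finsetSum _ fun i _ => integrable_of_continuous_of_ae_mem_Ioo hN (by fun_prop)]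
    simp_rw [integral_const_mul, h]
  have happrox : ∀ (L : Measure ℝ) [IsFiniteMeasure L], (∀ᵐ x ∂L, x ∈ Ioo (0 : ℝ) 1) →
      ∀ (f : ℝ → ℝ) (p : Polynomial ℝ) (ε : ℝ), Continuous f →
      (∀ x ∈ Icc (0 : ℝ) 1, |p.eval x - f x| < ε) →
      |∫ x, p.eval x ∂L - ∫ x, f x ∂L| ≤ ε * L.real univ := by
    intro L _ hL f p ε hf hp
    rw [← integral_sub (integrable_of_continuous_of_ae_mem_Ioo hL p.continuous)
      (integrable_of_continuous_of_ae_mem_Ioo hL hf), ← Real.norm_eq_abs]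
    refine norm_integral_le_of_norm_le_const (hL.mono fun x hx => ?_)
    exact (hp x (Ioo_subset_Icc_self hx)).le
  refine ext_of_forall_integral_eq_of_IsFiniteMeasure fun f => ?_
  refine eq_of_abs_sub_le_all fun ε hε => ?_
  -- The summand `1` keeps `C` positive even when both measures vanish.
  set C := M.real univ + N.real univ + 1 with hC
  have hC0 : 0 < C := by positivity
  obtain ⟨p, hp⟩ := exists_polynomial_near_of_continuousOn 0 1 f f.continuous.continuousOn
    (ε / C) (by positivity)
  have h1 := happrox M hM f p _ f.continuous hp
  have h2 := happrox N hN f p _ f.continuous hp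
  rw [hpoly p] at h1
  have h3 : ε / C * M.real univ + ε / C * N.real univ ≤ ε := by
    rw [← mul_add, div_mul_eq_mul_div, div_le_iff₀ hC0]
    gcongr
    linarith
  rw [abs_le] at *
  constructor <;> linarith [h1.1, h1.2, h2.1, h2.2]

/-! ### The substitution `u = e^{-y}` and canonical forms -/

theorem ae_pos_of_measure_Iic_zero {μ : Measure ℝ} (h0 : μ (Iic 0) = 0) : ∀ᵐ y ∂μ, 0 < y := by
  rw [ae_iff]
  simpa [Iic] using h0

theorem ae_map_exp_neg_mem_Ioo {μ : Measure ℝ} (h0 : μ (Iic 0) = 0) :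
    ∀ᵐ x ∂(μ.map fun y => Real.exp (-y)), x ∈ Ioo (0 : ℝ) 1 := by
  rw [ae_map_iff (p := fun x => x ∈ Ioo (0 : ℝ) 1) (by fun_prop) measurableSet_Ioo]
  exact (ae_pos_of_measure_Iic_zero h0).mono fun y hy => ⟨Real.exp_pos _, by simpa using hy⟩

/-- In the coordinate `u = e^{-y}`, the symmetry condition is invariance under `u ↦ 1 - u`. -/
theorem symmetryCondition_iff {μ : Measure ℝ} [IsFiniteMeasure μ] (h0 : μ (Iic 0) = 0) :
    SymmetryCondition μ ↔
      (μ.map fun y => Real.exp (-y)).map (fun u => 1 - u) = μ.map fun y => Real.exp (-y) := by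
  have hpos := ae_pos_of_measure_Iic_zero h0
  have hL : ∀ a : ℝ, 0 < a → a < 1 →
      (μ.map fun y => Real.exp (-y)) (Iic a) = μ (Ici (-Real.log a)) := by
    intro a ha _
    rw [Measure.map_apply (by fun_prop) measurableSet_Iic]
    congr 1
    ext y
    simp only [mem_preimage, mem_Iic, mem_Ici]
    rw [← Real.le_log_iff_exp_le ha]
    constructor <;> intro h <;> linarith
  have hR : ∀ a : ℝ, 0 < a → a < 1 →
      ((μ.map fun y => Real.exp (-y)).map fun u => 1 - u) (Iic a)
        = μ (Ioc 0 (-Real.log (1 - a))) := by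
    intro a ha ha1
    rw [Measure.map_map (by fun_prop) (by fun_prop),
      Measure.map_apply (by fun_prop) measurableSet_Iic]
    refine measure_congr (hpos.mono fun y hy => ?_)
    refine propext ?_
    change 1 - Real.exp (-y) ≤ a ↔ 0 < y ∧ y ≤ -Real.log (1 - a)
    rw [and_iff_right hy, le_neg, Real.log_le_iff_le_exp (by linarith)]
    constructor <;> intro h <;> linarith
  constructor
  · intro hs
    refine Measure.ext_of_Iic _ _ fun a => ?_
    -- Both measures live on `(0, 1)`, so only `0 < a < 1` uses the hypothesis, at `y = -log (1 -
    -- a)`.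
    rcases le_or_gt a 0 with ha | ha
    · rw [Measure.map_map (by fun_prop) (by fun_prop),
        Measure.map_apply (by fun_prop) measurableSet_Iic,
        Measure.map_apply (by fun_prop) measurableSet_Iic]
      refine measure_congr (hpos.mono fun y hy => propext ?_)
      change 1 - Real.exp (-y) ≤ a ↔ Real.exp (-y) ≤ a
      have h1 : Real.exp (-y) < 1 := by simpa using hy
      have h2 := Real.exp_pos (-y)
      constructor <;> intro h <;> linarith
    rcases le_or_gt 1 a with ha1 | ha1
    · rw [Measure.map_map (by fun_prop) (by fun_prop),
        Measure.map_apply (by fun_prop) measurableSet_Iic,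
        Measure.map_apply (by fun_prop) measurableSet_Iic]
      refine measure_congr (hpos.mono fun y hy => propext ?_)
      change 1 - Real.exp (-y) ≤ a ↔ Real.exp (-y) ≤ a
      have h1 : Real.exp (-y) < 1 := by simpa using hy
      have h2 := Real.exp_pos (-y)
      constructor <;> intro h <;> linarith
    · rw [hL a ha ha1, hR a ha ha1, hs _ (by
        have := Real.log_neg (x := 1 - a) (by linarith) (by linarith)
        linarith)]
      rw [neg_neg, Real.exp_log (by linarith), sub_sub_cancel]
  · intro hs y hy
    have h1 : Real.exp (-y) < 1 := by simpa using hy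
    have h2 := Real.exp_pos (-y)
    have h3 := hL (1 - Real.exp (-y)) (by linarith) (by linarith)
    rw [← hs, hR _ (by linarith) (by linarith), sub_sub_cancel, Real.log_exp, neg_neg] at h3
    exact h3

/-- With `u = e^{-y}` the weight is `1 / (u (1 - u))`, which cancels the factor `u (1 - u)` of the
difference. -/
theorem canonicalH_mul_sub {y : ℝ} (hy : 0 < y) (k : ℕ) :
    canonicalH y * (Real.exp (-y) ^ (k + 1) - Real.exp (-y) ^ (k + 2)) = Real.exp (-y) ^ k := by
  have h1 : Real.exp (-y) < 1 := by simpa using hy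
  have h2 := Real.exp_pos (-y)
  have h3 : Real.exp y = (Real.exp (-y))⁻¹ := by rw [Real.exp_neg, inv_inv]
  have h4 : 1 - Real.exp (-y) ≠ 0 := by linarith
  rw [canonicalH, h3]
  field_simp
  ring

theorem canonicalH_mul_sub_sum {y : ℝ} (hy : 0 < y) (k : ℕ) :
    canonicalH y * (Real.exp (-y) - Real.exp (-y) ^ (k + 1))
      = ∑ j ∈ Finset.range k, Real.exp (-y) ^ j := by
  induction k with
  | zero => simp
  | succ k ih =>
    rw [Finset.sum_range_succ, ← ih, ← canonicalH_mul_sub hy k]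
    ring

theorem exp_neg_natCast_mul (k : ℕ) (y : ℝ) : Real.exp (-((k : ℝ) * y)) = Real.exp (-y) ^ k := by
  rw [← Real.exp_nat_mul]
  ring_nf

/-- The differences of a function in canonical form at the integers are the moments of the
image of the canonical measure under `y ↦ e^{-y}`. -/
theorem IsCanonicalForm.moment_eq {s : ℝ → ℝ} {μ : Measure ℝ} {g : Ici (1 : ℝ) → ℝ} {ρ : ℕ → ℝ}
    (h : IsCanonicalForm s μ g) (hg : Extends g ρ) (k : ℕ) :
    ∫ u, u ^ k ∂(μ.map fun y => Real.exp (-y)) = ρ (k + 2) - ρ (k + 1) := by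
  rw [← hg (k + 2) (by lia), ← hg (k + 1) (by lia), h.eq_integral, h.eq_integral,
    ← integral_sub (h.integrable_kernel _) (h.integrable_kernel _),
    integral_map (by fun_prop) (by fun_prop)]
  have hr : μ.restrict (Ioi 0) = μ :=
    Measure.restrict_eq_self_of_ae_mem (ae_pos_of_measure_Iic_zero h.support)
  rw [hr]
  refine integral_congr_ae ((ae_pos_of_measure_Iic_zero h.support).mono fun y hy => ?_)
  dsimp only
  rw [exp_neg_natCast_mul, exp_neg_natCast_mul, ← canonicalH_mul_sub hy]
  ring

theorem measurable_canonicalH : Measurable canonicalH := by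
  unfold canonicalH
  fun_prop

/-- Every finite measure on `(0, ∞)` is a canonical measure, with centering function `e^{-y}`. -/
theorem isCanonicalForm_exp_neg {μ : Measure ℝ} [IsFiniteMeasure μ] (h0 : μ (Iic 0) = 0) :
    IsCanonicalForm (fun y => Real.exp (-y)) μ (fun x => ∫ y in Ioi (0 : ℝ),
      canonicalH y * (Real.exp (-y) - Real.exp (-((x : ℝ) * y))) ∂μ) := by
  have hnn : ∀ y : ℝ, 0 < y → 0 ≤ canonicalH y := by
    intro y hy
    have h1 : Real.exp (-y) < 1 := by simpa using hy
    exact div_nonneg (Real.exp_pos _).le (by linarith)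
  refine ⟨inferInstance, h0, by fun_prop, measurable_canonicalH, hnn, ?_, ?_, fun x => rfl⟩
  · refine Integrable.congr (integrable_const (1 : ℝ))
      ((ae_restrict_mem measurableSet_Ioi).mono fun y hy => ?_)
    have := canonicalH_mul_sub (mem_Ioi.1 hy) 0
    simp only [pow_zero, zero_add, pow_one] at this
    dsimp only
    linarith
  · intro x
    -- Raising `x` to the integer `n + 1` turns the integrand into a geometric sum of `n` terms,
    -- each at most `1`.
    obtain ⟨n, hn⟩ := exists_nat_ge (x : ℝ)
    have hx : (1 : ℝ) ≤ x := x.2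
    refine Integrable.mono' (integrable_const (n : ℝ))
      (measurable_canonicalH.mul (by fun_prop)).aestronglyMeasurable
      ((ae_restrict_mem measurableSet_Ioi).mono fun y hy => ?_)
    have hy : 0 < y := hy
    have h1 : Real.exp (-y) < 1 := by simpa using hy
    have h2 := Real.exp_pos (-y)
    have hle : Real.exp (-((x : ℝ) * y)) ≤ Real.exp (-y) := by
      rw [Real.exp_le_exp]
      nlinarith
    rw [Real.norm_of_nonneg (mul_nonneg (hnn y hy) (by linarith))]
    have hle2 : Real.exp (-y) ^ (n + 1) ≤ Real.exp (-((x : ℝ) * y)) := by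
      rw [← exp_neg_natCast_mul, Real.exp_le_exp]
      push_cast
      nlinarith
    calc canonicalH y * (Real.exp (-y) - Real.exp (-((x : ℝ) * y)))
        ≤ canonicalH y * (Real.exp (-y) - Real.exp (-y) ^ (n + 1)) := by
          have := hnn y hy
          gcongr
      _ = ∑ j ∈ Finset.range n, Real.exp (-y) ^ j := canonicalH_mul_sub_sum hy n
      _ ≤ ∑ j ∈ Finset.range n, (1 : ℝ) := by
          gcongr
          exact pow_le_one₀ h2.le h1.le
      _ = n := by simp

/-! ### Expected ranges in terms of the distribution function -/

theorem measurableSet_mem_Ico {α : Type*} [MeasurableSpace α] {f g : α → ℝ} (hf : Measurable f)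
    (hg : Measurable g) : MeasurableSet {p : α × ℝ | f p.1 ≤ p.2 ∧ p.2 < g p.1} :=
  (measurableSet_le (hf.comp measurable_fst) measurable_snd).inter
    (measurableSet_lt measurable_snd (hg.comp measurable_fst))

/-- Tonelli on the region `f ω ≤ x < g ω`. A general `ν` is kept because both Lebesgue measure and
`quantileMeasure` are needed. -/
theorem lintegral_measure_Ico_swap {α : Type*} [MeasurableSpace α] {P : Measure α} [SFinite P]
    {ν : Measure ℝ} [SFinite ν] {f g : α → ℝ} (hf : Measurable f) (hg : Measurable g) :
    ∫⁻ ω, ν (Ico (f ω) (g ω)) ∂P = ∫⁻ x, P {ω | f ω ≤ x ∧ x < g ω} ∂ν := by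
  have hS := measurableSet_mem_Ico hf hg
  exact (Measure.prod_apply hS).symm.trans (Measure.prod_apply_symm hS)

theorem measurable_measure_Ico {α : Type*} [MeasurableSpace α]
    {ν : Measure ℝ} [SFinite ν] {f g : α → ℝ} (hf : Measurable f) (hg : Measurable g) :
    Measurable fun ω => ν (Ico (f ω) (g ω)) := by
  have hS := measurableSet_mem_Ico hf hg
  exact measurable_measure_prodMk_left hS

/-- `∑_{j < k} (u ^ j + (1 - u) ^ j)`, which is
`(1 - u ^ (k + 1) - (1 - u) ^ (k + 1)) / (u (1 - u))`. -/
def rangeKernel (k : ℕ) (u : ℝ) : ℝ := ∑ j ∈ Finset.range k, (u ^ j + (1 - u) ^ j)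

theorem mul_rangeKernel (k : ℕ) (u : ℝ) :
    u * (1 - u) * rangeKernel k u = 1 - u ^ (k + 1) - (1 - u) ^ (k + 1) := by
  induction k with
  | zero => simp [rangeKernel]
  | succ k ih =>
    rw [rangeKernel, Finset.sum_range_succ, mul_add, ← rangeKernel, ih]
    ring

theorem continuous_rangeKernel (k : ℕ) : Continuous (rangeKernel k) := by
  unfold rangeKernel
  fun_prop

theorem rangeKernel_nonneg (k : ℕ) {u : ℝ} (h0 : 0 ≤ u) (h1 : u ≤ 1) : 0 ≤ rangeKernel k u :=
  Finset.sum_nonneg fun _ _ => add_nonneg (pow_nonneg h0 _) (pow_nonneg (by linarith) _)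

/-- The distribution function of `X`. -/
def distFun {Ω : Type} [MeasurableSpace Ω] (P : Measure Ω) (X : Ω → ℝ) (x : ℝ) : ℝ :=
  P.real {ω | X ω ≤ x}

theorem distFun_nonneg {Ω : Type} [MeasurableSpace Ω] {P : Measure Ω} {X : Ω → ℝ}
    (x : ℝ) : 0 ≤ distFun P X x := measureReal_nonneg

theorem iInf_le_iSup_comp {Ω : Type} {X : Ω → ℝ} {k : ℕ} (ω : Fin (k + 1) → Ω) :
    (⨅ i, X (ω i)) ≤ ⨆ i, X (ω i) :=
  ciInf_le_ciSup (finite_range _).bddBelow (finite_range _).bddAbove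

section Probability

variable {Ω : Type} [MeasurableSpace Ω] {P : Measure Ω} [IsProbabilityMeasure P] {X : Ω → ℝ}

theorem distFun_le_one (x : ℝ) : distFun P X x ≤ 1 := measureReal_le_one

theorem distFun_mul_nonneg (x : ℝ) : 0 ≤ distFun P X x * (1 - distFun P X x) :=
  mul_nonneg (distFun_nonneg x) (sub_nonneg.2 (distFun_le_one x))

theorem measurable_distFun : Measurable (distFun P X) := by
  refine Monotone.measurable fun x y hxy => measureReal_mono fun ω hω => ?_
  exact le_trans hω hxy

/-- The event fails exactly when all copies are `≤ x` or all are `> x`; these cases are disjoint,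
with probabilities `F ^ (k + 1)` and `(1 - F) ^ (k + 1)`. -/
theorem pi_measure_between (hX : Measurable X) (k : ℕ) (x : ℝ) :
    (Measure.pi fun _ : Fin (k + 1) => P) {ω | (⨅ i, X (ω i)) ≤ x ∧ x < ⨆ i, X (ω i)}
      = ENNReal.ofReal (distFun P X x * (1 - distFun P X x) * rangeKernel k (distFun P X x)) := by
  set A : Set (Fin (k + 1) → Ω) := univ.pi fun _ => {ω | X ω ≤ x} with hA
  set B : Set (Fin (k + 1) → Ω) := univ.pi fun _ => {ω | X ω ≤ x}ᶜ with hB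
  have hm : MeasurableSet {ω | X ω ≤ x} := measurableSet_le hX measurable_const
  have hAm : MeasurableSet A := MeasurableSet.univ_pi fun _ => hm
  have hBm : MeasurableSet B := MeasurableSet.univ_pi fun _ => hm.compl
  have hAB : Disjoint A B := by
    rw [disjoint_left]
    intro ω h1 h2
    exact h2 0 (mem_univ _) (h1 0 (mem_univ _))
  have hset : {ω : Fin (k + 1) → Ω | (⨅ i, X (ω i)) ≤ x ∧ x < ⨆ i, X (ω i)} = (A ∪ B)ᶜ := by
    ext ω
    have hi : (⨅ i, X (ω i)) ≤ x ↔ ω ∉ B := by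
      simp only [hB, mem_univ_pi, mem_compl_iff, mem_ofPred_eq, not_forall, not_not]
      constructor
      · intro h
        obtain ⟨i, hi⟩ := exists_eq_ciInf_of_finite (f := fun i => X (ω i))
        exact ⟨i, hi.trans_le h⟩
      · rintro ⟨i, hi⟩
        exact (ciInf_le (finite_range _).bddBelow i).trans hi
    have hs : x < (⨆ i, X (ω i)) ↔ ω ∉ A := by
      simp only [hA, mem_univ_pi, mem_ofPred_eq, not_forall, not_le]
      constructor
      · intro h
        obtain ⟨i, hi⟩ := exists_eq_ciSup_of_finite (f := fun i => X (ω i))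
        exact ⟨i, h.trans_eq hi.symm⟩
      · rintro ⟨i, hi⟩
        exact hi.trans_le (le_ciSup (f := fun i => X (ω i)) (finite_range _).bddAbove i)
    simp only [mem_ofPred_eq, hi, hs, mem_compl_iff, mem_union, not_or]
    exact and_comm
  have hAr : (Measure.pi fun _ : Fin (k + 1) => P).real A = distFun P X x ^ (k + 1) := by
    simp [hA, measureReal_def, Measure.pi_pi, distFun]
  have hBr : (Measure.pi fun _ : Fin (k + 1) => P).real B = (1 - distFun P X x) ^ (k + 1) := by
    rw [hB, measureReal_def, Measure.pi_pi]
    simp only [ENNReal.toReal_prod, ← measureReal_def, probReal_compl_eq_one_sub hm]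
    simp [distFun]
  rw [hset, ← ofReal_measureReal, probReal_compl_eq_one_sub (hAm.union hBm),
    measureReal_union hAB hBm, hAr, hBr, mul_rangeKernel, sub_sub]

theorem measurable_iSup_comp (hX : Measurable X) (k : ℕ) :
    Measurable fun ω : Fin k → Ω => ⨆ i, X (ω i) :=
  Measurable.iSup fun i => hX.comp (measurable_pi_apply i)

theorem measurable_iInf_comp (hX : Measurable X) (k : ℕ) :
    Measurable fun ω : Fin k → Ω => ⨅ i, X (ω i) :=
  Measurable.iInf fun i => hX.comp (measurable_pi_apply i)

theorem lintegral_measure_Ico_range {ν : Measure ℝ} [SFinite ν] (hX : Measurable X) (k : ℕ) :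
    ∫⁻ ω, ν (Ico (⨅ i, X (ω i)) (⨆ i, X (ω i))) ∂(Measure.pi fun _ : Fin (k + 1) => P)
      = ∫⁻ x, ENNReal.ofReal
          (distFun P X x * (1 - distFun P X x) * rangeKernel k (distFun P X x)) ∂ν := by
  rw [lintegral_measure_Ico_swap (measurable_iInf_comp hX _) (measurable_iSup_comp hX _)]
  simp_rw [pi_measure_between hX]

theorem integral_measure_Ico_range {ν : Measure ℝ} [SFinite ν] (hX : Measurable X) (k : ℕ)
    (hfin : ∀ᵐ ω ∂(Measure.pi fun _ : Fin (k + 1) => P),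
      ν (Ico (⨅ i, X (ω i)) (⨆ i, X (ω i))) < ⊤) :
    ∫ ω, ν.real (Ico (⨅ i, X (ω i)) (⨆ i, X (ω i))) ∂(Measure.pi fun _ : Fin (k + 1) => P)
      = ∫ x, distFun P X x * (1 - distFun P X x) * rangeKernel k (distFun P X x) ∂ν := by
  have hF : Measurable (distFun P X) := measurable_distFun
  have hK : Measurable fun x => rangeKernel k (distFun P X x) :=
    (continuous_rangeKernel k).measurable.comp hF
  rw [integral_eq_lintegral_of_nonneg_ae
    (.of_forall fun x => mul_nonneg (distFun_mul_nonneg x)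
      (rangeKernel_nonneg k (distFun_nonneg x) (distFun_le_one x)))
    (Measurable.aestronglyMeasurable (by fun_prop)), ← lintegral_measure_Ico_range hX]
  exact integral_toReal (measurable_measure_Ico (measurable_iInf_comp hX _)
    (measurable_iSup_comp hX _)).aemeasurable hfin

theorem expectedRange_succ (hX : Measurable X) (k : ℕ) :
    expectedRange P X (k + 1)
      = ∫ x, distFun P X x * (1 - distFun P X x) * rangeKernel k (distFun P X x) := by
  rw [← integral_measure_Ico_range hX k (by simp), expectedRange]
  refine integral_congr_ae (.of_forall fun ω => ?_)
  simp [sub_nonneg.2 (iInf_le_iSup_comp (X := X) ω)]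

theorem integrable_range (hX : Integrable X P) (hm : Measurable X) (k : ℕ) :
    Integrable (fun ω : Fin (k + 1) → Ω => (⨆ i, X (ω i)) - ⨅ i, X (ω i))
      (Measure.pi fun _ => P) := by
  have hi : ∀ i : Fin (k + 1), Integrable (fun ω : Fin (k + 1) → Ω => |X (ω i)|)
      (Measure.pi fun _ => P) := fun i =>
    ((measurePreserving_eval (fun _ : Fin (k + 1) => P) i).integrable_comp_of_integrable hX).abs
  have hs := integrable_finsetSum (Finset.univ : Finset (Fin (k + 1))) fun i _ => hi i
  refine Integrable.mono' (hs.add hs)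
    ((measurable_iSup_comp hm _).sub (measurable_iInf_comp hm _)).aestronglyMeasurable
    (.of_forall fun ω => ?_)
  obtain ⟨i, hi⟩ := exists_eq_ciSup_of_finite (f := fun i => X (ω i))
  obtain ⟨j, hj⟩ := exists_eq_ciInf_of_finite (f := fun i => X (ω i))
  have h1 := Finset.single_le_sum (f := fun i => |X (ω i)|) (fun i _ => abs_nonneg _)
    (Finset.mem_univ i)
  have h2 := Finset.single_le_sum (f := fun i => |X (ω i)|) (fun i _ => abs_nonneg _)
    (Finset.mem_univ j)
  rw [← hi, ← hj]
  exact (norm_sub_le _ _).trans (add_le_add h1 h2)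

theorem integrable_distFun_mul (hX : Integrable X P) (hm : Measurable X) :
    Integrable fun x => distFun P X x * (1 - distFun P X x) := by
  have hF : Measurable (distFun P X) := measurable_distFun
  have hF2 : Measurable fun x => distFun P X x * (1 - distFun P X x) := by fun_prop
  refine ⟨hF2.aestronglyMeasurable, ?_⟩
  rw [hasFiniteIntegral_iff_ofReal (.of_forall distFun_mul_nonneg)]
  -- For two copies the kernel is the constant `2`, so the finite expected range dominates `∫ F (1 -
  -- F)`.
  have h := lintegral_measure_Ico_range (P := P) (ν := volume) hm 1
  have h2 := (integrable_range hX hm 1).lintegral_lt_top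
  simp only [Real.volume_Ico] at h
  rw [h] at h2
  refine lt_of_le_of_lt (lintegral_mono fun x => ENNReal.ofReal_le_ofReal ?_) h2
  have := distFun_mul_nonneg (P := P) (X := X) x
  simp only [rangeKernel, Finset.sum_range_one, pow_zero]
  linarith

theorem exists_ae_eq_const_of_expectedRange_two (hX : Integrable X P) (hm : Measurable X)
    (h : expectedRange P X 2 = 0) : ∃ c : ℝ, ∀ᵐ ω ∂P, X ω = c := by
  rw [expectedRange, integral_eq_zero_iff_of_nonneg
    (fun ω => sub_nonneg.2 (iInf_le_iSup_comp (X := X) ω)) (integrable_range hX hm 1)] at h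
  have h2 : ∀ᵐ ω ∂(Measure.pi fun _ : Fin 2 => P), X (ω 0) = X (ω 1) := by
    filter_upwards [h] with ω hω
    have hω : (⨆ i, X (ω i)) - (⨅ i, X (ω i)) = 0 := hω
    have hl : ∀ i, (⨅ i, X (ω i)) ≤ X (ω i) := ciInf_le (finite_range _).bddBelow
    have hu : ∀ i, X (ω i) ≤ ⨆ i, X (ω i) :=
      le_ciSup (f := fun i => X (ω i)) (finite_range _).bddAbove
    linarith [hl 0, hl 1, hu 0, hu 1]
  have h3 : ∀ᵐ p ∂(P.prod P), X p.1 = X p.2 := by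
    rw [← (measurePreserving_finTwoArrow P).map_eq,
      ae_map_iff (MeasurableEquiv.measurable _).aemeasurable
        (measurableSet_eq_fun (by fun_prop) (by fun_prop))]
    exact h2
  obtain ⟨ω, hω⟩ := (Measure.ae_ae_of_ae_prod h3).exists
  exact ⟨X ω, hω.mono fun _ h => h.symm⟩

theorem expectedRange_eq_zero_of_ae_eq_const {c : ℝ} (hc : ∀ᵐ ω ∂P, X ω = c) (k : ℕ) :
    expectedRange P X (k + 1) = 0 := by
  refine integral_eq_zero_of_ae ?_
  have h : ∀ i : Fin (k + 1), ∀ᵐ ω ∂(Measure.pi fun _ : Fin (k + 1) => P), X (ω i) = c := fun i =>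
    (measurePreserving_eval (fun _ : Fin (k + 1) => P) i).quasiMeasurePreserving.ae hc
  filter_upwards [ae_all_iff.2 h] with ω hω
  simp [hω]

end Probability

/-! ### From an expected ranges sequence to a symmetric measure -/

/-- Differences of an expected ranges sequence are the moments of a finite measure on `(0, 1)`
that is symmetric about `1 / 2`. -/
theorem IsERSOfNonDegenerate.exists_symmetric_measure {ρ : ℕ → ℝ} (h : IsERSOfNonDegenerate ρ) :
    ρ 1 = 0 ∧ ρ 2 ≠ 0 ∧ ∃ M : Measure ℝ, IsFiniteMeasure M ∧ (∀ᵐ u ∂M, u ∈ Ioo (0 : ℝ) 1) ∧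
      M.map (fun u => 1 - u) = M ∧ ∀ k : ℕ, ∫ u, u ^ k ∂M = ρ (k + 2) - ρ (k + 1) := by
  obtain ⟨Ω, _, P, X, _, hm, hX, hnd, hρ⟩ := h
  refine ⟨?_, ?_, ?_⟩
  · rw [← hρ 1 le_rfl, ← zero_add 1, expectedRange_succ hm]
    simp [rangeKernel]
  · rw [← hρ 2 one_le_two]
    exact fun h => hnd (exists_ae_eq_const_of_expectedRange_two hX hm h)
  set F := distFun P X with hFdef
  have hF : Measurable F := measurable_distFun
  have hint := integrable_distFun_mul hX hm
  have hFm : Measurable fun x => ENNReal.ofReal (F x * (1 - F x)) := by fun_prop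
  set L : Measure ℝ := volume.withDensity fun x => ENNReal.ofReal (F x * (1 - F x)) with hL
  have hLfin : IsFiniteMeasure L := isFiniteMeasure_withDensity_ofReal hint.2
  -- The density `F (1 - F)` vanishes wherever `F` is `0` or `1`.
  have hLF : ∀ᵐ x ∂L, 0 < F x ∧ F x < 1 := by
    rw [hL, ae_withDensity_iff hFm]
    refine .of_forall fun x hx => ?_
    have h0 := distFun_nonneg (P := P) (X := X) x
    have h1 := distFun_le_one (P := P) (X := X) x
    have hx : 0 < F x * (1 - F x) := by simpa using hx
    constructor
    · exact lt_of_le_of_ne h0 fun h => by simp [← h] at hx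
    · exact lt_of_le_of_ne h1 fun h => by simp [h] at hx
  have hG : Measurable fun x => 1 - F x := by fun_prop
  have hFM : ∀ᵐ u ∂(L.map F), u ∈ Ioo (0 : ℝ) 1 := by
    rw [ae_map_iff (p := fun u => u ∈ Ioo (0 : ℝ) 1) hF.aemeasurable measurableSet_Ioo]
    exact hLF
  have hGM : ∀ᵐ u ∂(L.map fun x => 1 - F x), u ∈ Ioo (0 : ℝ) 1 := by
    rw [ae_map_iff (p := fun u => u ∈ Ioo (0 : ℝ) 1) hG.aemeasurable measurableSet_Ioo]
    exact hLF.mono fun x hx => ⟨by linarith [hx.2], by linarith [hx.1]⟩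
  refine ⟨L.map F + L.map fun x => 1 - F x, inferInstance, ae_add_measure_iff.2 ⟨hFM, hGM⟩, ?_, ?_⟩
  · rw [Measure.map_add _ _ (by fun_prop), Measure.map_map (by fun_prop) hF,
      Measure.map_map (by fun_prop) hG, add_comm]
    congr 1
    congr 1
    ext x
    simp
  · intro k
    have hb : ∀ j : ℕ, ∀ x, |F x * (1 - F x) * rangeKernel j (F x)| ≤
        F x * (1 - F x) * (2 * j) := by
      intro j x
      have h0 := distFun_nonneg (P := P) (X := X) x
      have h1 := distFun_le_one (P := P) (X := X) x
      have h2 := distFun_mul_nonneg (P := P) (X := X) x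
      rw [abs_of_nonneg (mul_nonneg h2 (rangeKernel_nonneg _ h0 h1))]
      refine mul_le_mul_of_nonneg_left ?_ h2
      calc rangeKernel j (F x) ≤ ∑ _i ∈ Finset.range j, (1 + 1 : ℝ) := by
            refine Finset.sum_le_sum fun i _ => add_le_add (pow_le_one₀ h0 h1)
              (pow_le_one₀ (by linarith) (by linarith))
        _ = 2 * j := by simp; ring
    have hi : ∀ j : ℕ, Integrable fun x => F x * (1 - F x) * rangeKernel j (F x) := by
      intro j
      have hK : Measurable fun x => rangeKernel j (F x) :=
        (continuous_rangeKernel j).measurable.comp hF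
      exact (hint.mul_const (2 * (j : ℝ))).mono' (Measurable.aestronglyMeasurable (by fun_prop))
        (.of_forall (hb j))
    have h1 : Integrable (fun x => F x ^ k) L :=
      (integrable_of_continuous_of_ae_mem_Ioo hFM (continuous_pow k)).comp_measurable hF
    have h2 : Integrable (fun x => (1 - F x) ^ k) L :=
      (integrable_of_continuous_of_ae_mem_Ioo hGM (continuous_pow k)).comp_measurable hG
    rw [integral_add_measure (integrable_of_continuous_of_ae_mem_Ioo hFM (continuous_pow k))
      (integrable_of_continuous_of_ae_mem_Ioo hGM (continuous_pow k)),
      integral_map hF.aemeasurable (by fun_prop), integral_map hG.aemeasurable (by fun_prop),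
      ← integral_add h1 h2, ← hρ (k + 2) (by lia), ← hρ (k + 1) (by lia), expectedRange_succ hm,
      expectedRange_succ hm, ← integral_sub (hi _) (hi _), hL,
      integral_withDensity_eq_integral_toReal_smul hFm (by simp)]
    refine integral_congr_ae (.of_forall fun x => ?_)
    dsimp only
    rw [ENNReal.toReal_ofReal (distFun_mul_nonneg x), smul_eq_mul, ← mul_sub]
    simp [rangeKernel, Finset.sum_range_succ, hFdef]

theorem map_exp_neg_map_neg_log {M : Measure ℝ} (hM : ∀ᵐ u ∂M, u ∈ Ioo (0 : ℝ) 1) :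
    (M.map fun u => -Real.log u).map (fun y => Real.exp (-y)) = M := by
  rw [Measure.map_map (by fun_prop) (by fun_prop)]
  conv_rhs => rw [← Measure.map_id (μ := M)]
  refine Measure.map_congr (hM.mono fun u hu => ?_)
  simp [Real.exp_log hu.1]

theorem map_neg_log_Iic_zero {M : Measure ℝ} (hM : ∀ᵐ u ∂M, u ∈ Ioo (0 : ℝ) 1) :
    (M.map fun u => -Real.log u) (Iic 0) = 0 := by
  rw [Measure.map_apply (by fun_prop) measurableSet_Iic]
  refine measure_eq_zero_iff_ae_notMem.2 (hM.mono fun u hu h => ?_)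
  have := Real.log_neg hu.1 hu.2
  have h : -Real.log u ≤ 0 := h
  linarith

theorem IsERSOfNonDegenerate.exists_canonicalForm {ρ : ℕ → ℝ} (h : IsERSOfNonDegenerate ρ) :
    ∃ g ∈ GStar, Extends g ρ ∧
      ∃ (s : ℝ → ℝ) (μ : Measure ℝ), IsCanonicalForm s μ g ∧ SymmetryCondition μ := by
  obtain ⟨h1, h2, M, _, hM, hsymm, hmom⟩ := h.exists_symmetric_measure
  set μ : Measure ℝ := M.map fun u => -Real.log u with hμ
  have h0 : μ (Iic 0) = 0 := map_neg_log_Iic_zero hM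
  have hE : μ.map (fun y => Real.exp (-y)) = M := map_exp_neg_map_neg_log hM
  have hcan := isCanonicalForm_exp_neg h0
  set g : Ici (1 : ℝ) → ℝ := fun x => ∫ y in Ioi (0 : ℝ),
      canonicalH y * (Real.exp (-y) - Real.exp (-((x : ℝ) * y))) ∂μ with hg
  have hext : Extends g ρ := by
    intro k hk
    -- `g` trivially extends its own integer values, so the moment formula applies to it before
    -- `Extends g ρ` is known; the default at `0` is never used.
    have hself : Extends g fun n =>
        if hn : 1 ≤ n then g ⟨n, mem_Ici.2 (Nat.one_le_cast.2 hn)⟩ else 0 :=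
      fun n hn => by simp [hn]
    induction k, hk using Nat.le_induction with
    | base => simp [hg, h1]
    | succ n hn ih =>
      obtain ⟨m, rfl⟩ := Nat.exists_eq_add_of_le' hn
      have := hcan.moment_eq hself m
      rw [hE, hmom, dif_pos (by lia), dif_pos (by lia), ih] at this
      linarith
  refine ⟨g, ⟨⟨_, _, _, hcan⟩, ⟨_, mem_Ici.2 (Nat.one_le_cast.2 le_rfl)⟩,
    ⟨_, mem_Ici.2 (Nat.one_le_cast.2 one_le_two)⟩, ?_⟩, hext, _, μ, hcan, ?_⟩
  · rw [hext 1 le_rfl, hext 2 one_le_two, h1]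
    exact h2.symm
  · rw [symmetryCondition_iff h0, hE, hsymm]

theorem IsERSOfNonDegenerate.symmetryCondition {ρ : ℕ → ℝ} (h : IsERSOfNonDegenerate ρ)
    {g : Ici (1 : ℝ) → ℝ} (hg : Extends g ρ) {s : ℝ → ℝ} {μ : Measure ℝ}
    (hμ : IsCanonicalForm s μ g) : SymmetryCondition μ := by
  obtain ⟨-, -, M, _, hM, hsymm, hmom⟩ := h.exists_symmetric_measure
  have := hμ.finite
  have hE : μ.map (fun y => Real.exp (-y)) = M :=
    measure_ext_of_moments (ae_map_exp_neg_mem_Ioo hμ.support) hM fun k => by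
      rw [hmom, hμ.moment_eq hg]
  rw [symmetryCondition_iff hμ.support, hE, hsymm]

/-! ### From a symmetric measure to a random variable -/

/-- The measure `M(du) / (2 u (1 - u))`. -/
noncomputable def quantileMeasure (M : Measure ℝ) : Measure ℝ :=
  M.withDensity fun x => ENNReal.ofReal (2 * (x * (1 - x)))⁻¹

/-- The left-continuous function on `(0, 1)` vanishing at `1 / 2` with increments given by `ν`. -/
noncomputable def quantileFun (ν : Measure ℝ) (u : ℝ) : ℝ :=
  ν.real (Ico (1 / 2) u) - ν.real (Ico u (1 / 2))

/-- The uniform distribution on `(0, 1)`. -/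
noncomputable def unifMeasure : Measure ℝ := volume.restrict (Ioo 0 1)

instance : IsProbabilityMeasure unifMeasure := ⟨by simp [unifMeasure]⟩

theorem ae_unifMeasure : ∀ᵐ u ∂unifMeasure, u ∈ Ioo (0 : ℝ) 1 := ae_restrict_mem measurableSet_Ioo

theorem distFun_unifMeasure {x : ℝ} (hx : x ∈ Ioo (0 : ℝ) 1) : distFun unifMeasure id x = x := by
  have : {ω : ℝ | id ω ≤ x} ∩ Ioo 0 1 = Ioc 0 x := by
    ext ω
    exact ⟨fun h => ⟨h.2.1, h.1⟩, fun h => ⟨h.2, h.1, h.2.trans_lt hx.2⟩⟩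
  rw [distFun, unifMeasure, measureReal_restrict_apply (measurableSet_le measurable_id
    measurable_const), this]
  simp [hx.1.le]

theorem ae_quantileMeasure {M : Measure ℝ} (hM : ∀ᵐ u ∂M, u ∈ Ioo (0 : ℝ) 1) :
    ∀ᵐ u ∂(quantileMeasure M), u ∈ Ioo (0 : ℝ) 1 :=
  (withDensity_absolutelyContinuous _ _).ae_le hM

section Quantile

variable {M : Measure ℝ} [IsFiniteMeasure M]

instance : SFinite (quantileMeasure M) := by
  unfold quantileMeasure
  infer_instance

/-- The density blows up only at `0` and `1`; total mass may be infinite, but increments inside `(0,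
1)` are finite. -/
theorem quantileMeasure_Ico_lt_top {a b : ℝ} (ha : 0 < a) (hb : b < 1) :
    quantileMeasure M (Ico a b) < ⊤ := by
  rw [quantileMeasure, withDensity_apply _ measurableSet_Ico]
  refine lt_of_le_of_lt (setLIntegral_mono (g := fun _ => ENNReal.ofReal (2 * (a * (1 - b)))⁻¹)
    measurable_const fun x hx => ?_) ?_
  · refine ENNReal.ofReal_le_ofReal (inv_anti₀ ?_ ?_)
    · have := mul_pos ha (sub_pos.2 hb)
      linarith
    · have : a * (1 - b) ≤ x * (1 - x) :=
        mul_le_mul hx.1 (by linarith [hx.2]) (by linarith) (by linarith [hx.1])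
      linarith
  · rw [setLIntegral_const]
    exact ENNReal.mul_lt_top ENNReal.ofReal_lt_top (measure_lt_top _ _)

theorem quantileFun_sub {a b : ℝ} (ha : 0 < a) (hab : a ≤ b) (hb : b < 1) :
    quantileFun (quantileMeasure M) b - quantileFun (quantileMeasure M) a
      = (quantileMeasure M).real (Ico a b) := by
  have hadd : ∀ p q r : ℝ, 0 < p → p ≤ q → q ≤ r → r < 1 → (quantileMeasure M).real (Ico p r)
      = (quantileMeasure M).real (Ico p q) + (quantileMeasure M).real (Ico q r) := by
    intro p q r hp hpq hqr hr
    rw [← Ico_union_Ico_eq_Ico hpq hqr]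
    exact measureReal_union (Ico_disjoint_Ico_same) measurableSet_Ico
      (quantileMeasure_Ico_lt_top hp (by linarith)).ne
      (quantileMeasure_Ico_lt_top (by linarith) hr).ne
  unfold quantileFun
  rcases le_total (1 / 2) a with h | h
  · rw [Ico_eq_empty_of_le h, Ico_eq_empty_of_le (h.trans hab),
      hadd (1 / 2) a b (by norm_num) h hab hb]
    simp
  · rcases le_total (1 / 2) b with h' | h'
    · rw [Ico_eq_empty_of_le h, Ico_eq_empty_of_le h', hadd a (1 / 2) b ha h h' hb]
      simp [add_comm]
    · rw [Ico_eq_empty_of_le h, Ico_eq_empty_of_le h',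
        hadd a b (1 / 2) ha hab h' (by norm_num)]
      simp

theorem measurable_quantileFun : Measurable (quantileFun (quantileMeasure M)) :=
  (measurable_measure_Ico measurable_const measurable_id).ennreal_toReal.sub
    (measurable_measure_Ico measurable_id measurable_const).ennreal_toReal

theorem lintegral_quantileMeasure_lt_top (hM : ∀ᵐ u ∂M, u ∈ Ioo (0 : ℝ) 1) :
    ∫⁻ x, ENNReal.ofReal (2 * (x * (1 - x))) ∂(quantileMeasure M) < ⊤ := by
  rw [quantileMeasure, lintegral_withDensity_eq_lintegral_mul _ (by fun_prop) (by fun_prop)]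
  have : ∫⁻ _, 1 ∂M < ⊤ := by simp
  refine lt_of_le_of_lt (lintegral_mono_ae (hM.mono fun x hx => ?_)) this
  have h : 0 < 2 * (x * (1 - x)) := by
    have := mul_pos hx.1 (sub_pos.2 hx.2)
    linarith
  rw [Pi.mul_apply, ← ENNReal.ofReal_mul (by positivity), inv_mul_cancel₀ h.ne', ENNReal.ofReal_one]

/-- Tonelli gives `x` the weight `1 - x` if `1 / 2 ≤ x` and `x` otherwise, both at most `2 x (1 -
x)`, which the density of `quantileMeasure` cancels. -/
theorem integrable_quantileFun (hM : ∀ᵐ u ∂M, u ∈ Ioo (0 : ℝ) 1) :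
    Integrable (quantileFun (quantileMeasure M)) unifMeasure := by
  have hfin := lintegral_quantileMeasure_lt_top hM
  refine Integrable.sub
    (integrable_toReal_of_lintegral_ne_top
      (measurable_measure_Ico measurable_const measurable_id).aemeasurable ?_)
    (integrable_toReal_of_lintegral_ne_top
      (measurable_measure_Ico measurable_id measurable_const).aemeasurable ?_)
  · refine (lt_of_le_of_lt ?_ hfin).ne
    refine (lintegral_measure_Ico_swap measurable_const measurable_id).trans_le ?_
    refine lintegral_mono_ae ((ae_quantileMeasure hM).mono fun x hx => ?_)
    by_cases h : 1 / 2 ≤ x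
    · calc unifMeasure {u | 1 / 2 ≤ x ∧ x < id u} ≤ volume (Ioo x 1) := by
            rw [unifMeasure, Measure.restrict_apply' measurableSet_Ioo]
            exact measure_mono fun u hu => ⟨hu.1.2, hu.2.2⟩
        _ ≤ _ := by
            rw [Real.volume_Ioo]
            refine ENNReal.ofReal_le_ofReal ?_
            nlinarith [hx.2]
    · exact (measure_mono_null (fun u hu => absurd hu.1 h) measure_empty).trans_le zero_le
  · refine (lt_of_le_of_lt ?_ hfin).ne
    refine (lintegral_measure_Ico_swap measurable_id measurable_const).trans_le ?_
    refine lintegral_mono_ae ((ae_quantileMeasure hM).mono fun x hx => ?_)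
    by_cases h : x < 1 / 2
    · calc unifMeasure {u | id u ≤ x ∧ x < 1 / 2} ≤ volume (Ioc 0 x) := by
            rw [unifMeasure, Measure.restrict_apply' measurableSet_Ioo]
            exact measure_mono fun u hu => ⟨hu.2.1, hu.1.1⟩
        _ ≤ _ := by
            rw [Real.volume_Ioc]
            refine ENNReal.ofReal_le_ofReal ?_
            nlinarith [hx.1]
    · exact (measure_mono_null (fun u hu => absurd hu.2 h) measure_empty).trans_le zero_le

theorem range_quantileFun {k : ℕ} {ω : Fin (k + 1) → ℝ} (hω : ∀ i, ω i ∈ Ioo (0 : ℝ) 1) :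
    (⨆ i, quantileFun (quantileMeasure M) (ω i)) - (⨅ i, quantileFun (quantileMeasure M) (ω i))
      = (quantileMeasure M).real (Ico (⨅ i, ω i) (⨆ i, ω i)) := by
  have hmono : ∀ i j, ω i ≤ ω j →
      quantileFun (quantileMeasure M) (ω i) ≤ quantileFun (quantileMeasure M) (ω j) := by
    intro i j h
    have := quantileFun_sub (M := M) (hω i).1 h (hω j).2
    have h2 := measureReal_nonneg (μ := quantileMeasure M) (s := Ico (ω i) (ω j))
    linarith
  obtain ⟨i, hi⟩ := exists_eq_ciSup_of_finite (f := ω)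
  obtain ⟨j, hj⟩ := exists_eq_ciInf_of_finite (f := ω)
  have hsup : (⨆ l, quantileFun (quantileMeasure M) (ω l)) =
      quantileFun (quantileMeasure M) (ω i) :=
    le_antisymm (ciSup_le fun l => hmono l i (hi ▸ le_ciSup (finite_range ω).bddAbove l))
      (le_ciSup (f := fun l => quantileFun (quantileMeasure M) (ω l)) (finite_range _).bddAbove i)
  have hinf : (⨅ l, quantileFun (quantileMeasure M) (ω l)) =
      quantileFun (quantileMeasure M) (ω j) :=
    le_antisymm
      (ciInf_le (f := fun l => quantileFun (quantileMeasure M) (ω l)) (finite_range _).bddBelow j)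
      (le_ciInf fun l => hmono j l (hj ▸ ciInf_le (finite_range ω).bddBelow l))
  rw [hsup, hinf, ← hi, ← hj]
  exact quantileFun_sub (hω j).1 (hj ▸ ciInf_le (finite_range ω).bddBelow i) (hω i).2

theorem ae_pi_unifMeasure (k : ℕ) :
    ∀ᵐ ω ∂(Measure.pi fun _ : Fin (k + 1) => unifMeasure), ∀ i, ω i ∈ Ioo (0 : ℝ) 1 :=
  ae_all_iff.2 fun i =>
    (measurePreserving_eval (fun _ : Fin (k + 1) => unifMeasure) i).quasiMeasurePreserving.ae
      ae_unifMeasure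

/-- By monotonicity the range is the `quantileMeasure` of the interval spanned by the uniform
sample. Uniform variables have `F x = x`, so the factor `x (1 - x)` cancels the density up to `1 /
2`. -/
theorem expectedRange_quantileFun (hM : ∀ᵐ u ∂M, u ∈ Ioo (0 : ℝ) 1) (k : ℕ) :
    expectedRange unifMeasure (quantileFun (quantileMeasure M)) (k + 1)
      = ∫ u, rangeKernel k u / 2 ∂M := by
  have h1 : expectedRange unifMeasure (quantileFun (quantileMeasure M)) (k + 1)
      = ∫ ω, (quantileMeasure M).real (Ico (⨅ i, id (ω i)) (⨆ i, id (ω i)))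
        ∂(Measure.pi fun _ : Fin (k + 1) => unifMeasure) :=
    integral_congr_ae ((ae_pi_unifMeasure k).mono fun ω hω => range_quantileFun hω)
  rw [h1, integral_measure_Ico_range measurable_id]
  · have h2 : ∫ x, distFun unifMeasure id x * (1 - distFun unifMeasure id x)
          * rangeKernel k (distFun unifMeasure id x) ∂(quantileMeasure M)
        = ∫ x, x * (1 - x) * rangeKernel k x ∂(quantileMeasure M) :=
      integral_congr_ae ((ae_quantileMeasure hM).mono fun x hx => by
        simp only [distFun_unifMeasure hx])
    rw [h2, quantileMeasure, integral_withDensity_eq_integral_toReal_smul (by fun_prop) (by simp)]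
    refine integral_congr_ae (hM.mono fun x hx => ?_)
    have h := mul_pos hx.1 (sub_pos.2 hx.2)
    have hx0 : x ≠ 0 := hx.1.ne'
    have hx1 : 1 - x ≠ 0 := (sub_pos.2 hx.2).ne'
    dsimp only
    rw [ENNReal.toReal_ofReal (by positivity), smul_eq_mul]
    field_simp
  · filter_upwards [ae_pi_unifMeasure k] with ω hω
    obtain ⟨i, hi⟩ := exists_eq_ciSup_of_finite (f := fun i => id (ω i))
    obtain ⟨j, hj⟩ := exists_eq_ciInf_of_finite (f := fun i => id (ω i))
    rw [← hi, ← hj]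
    exact quantileMeasure_Ico_lt_top (hω j).1 (hω i).2

/-- Symmetry makes `u ^ j` and `(1 - u) ^ j` integrate equally, which absorbs the factor `1 / 2`. -/
theorem integral_rangeKernel_of_symmetric (hM : ∀ᵐ u ∂M, u ∈ Ioo (0 : ℝ) 1)
    (hsymm : M.map (fun u => 1 - u) = M) (k : ℕ) :
    ∫ u, rangeKernel k u / 2 ∂M = ∑ j ∈ Finset.range k, ∫ u, u ^ j ∂M := by
  rw [integral_div]
  unfold rangeKernel
  rw [integral_finsetSum _ fun j _ => integrable_of_continuous_of_ae_mem_Ioo hM (by fun_prop),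
    Finset.sum_div]
  refine Finset.sum_congr rfl fun j _ => ?_
  rw [integral_add (integrable_of_continuous_of_ae_mem_Ioo hM (by fun_prop))
    (integrable_of_continuous_of_ae_mem_Ioo hM (by fun_prop))]
  have : ∫ u, (1 - u) ^ j ∂M = ∫ u, u ^ j ∂M := by
    conv_rhs => rw [← hsymm]
    rw [integral_map (by fun_prop) (by fun_prop)]
  rw [this]
  ring

end Quantile

/-- A sequence starting at `0` whose differences are the moments of a nonzero symmetric finite
measure on `(0, 1)` is an expected ranges sequence. -/
theorem isERSOfNonDegenerate_of_moments {ρ : ℕ → ℝ} {M : Measure ℝ} [IsFiniteMeasure M]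
    (hM : ∀ᵐ u ∂M, u ∈ Ioo (0 : ℝ) 1) (hsymm : M.map (fun u => 1 - u) = M) (hM0 : M ≠ 0)
    (h1 : ρ 1 = 0) (hmom : ∀ k : ℕ, ∫ u, u ^ k ∂M = ρ (k + 2) - ρ (k + 1)) :
    IsERSOfNonDegenerate ρ := by
  have hE : ∀ k, expectedRange unifMeasure (quantileFun (quantileMeasure M)) (k + 1)
      = ρ (k + 1) := by
    intro k
    rw [expectedRange_quantileFun hM, integral_rangeKernel_of_symmetric hM hsymm]
    simp_rw [hmom]
    rw [Finset.sum_range_sub (fun j => ρ (j + 1)) k]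
    simp [h1]
  refine ⟨ℝ, inferInstance, unifMeasure, quantileFun (quantileMeasure M), inferInstance,
    measurable_quantileFun, integrable_quantileFun hM, ?_, fun k hk => ?_⟩
  · rintro ⟨c, hc⟩
    -- `ρ 2 - ρ 1` is the total mass of `M`, so a degenerate variable would force `M = 0`.
    have h2 := hE 1
    rw [expectedRange_eq_zero_of_ae_eq_const hc] at h2
    have h3 := hmom 0
    simp only [pow_zero, integral_const, smul_eq_mul, mul_one, zero_add, h1, sub_zero] at h3
    rw [← h2, measureReal_eq_zero_iff, Measure.measure_univ_eq_zero] at h3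
    exact hM0 h3
  · obtain ⟨m, rfl⟩ := Nat.exists_eq_add_of_le' hk
    exact hE m

theorem isERSOfNonDegenerate_of_canonicalForm {ρ : ℕ → ℝ} (h1 : ρ 1 = 0) {g : Ici (1 : ℝ) → ℝ}
    (hg : g ∈ GStar) (hext : Extends g ρ) {s : ℝ → ℝ} {μ : Measure ℝ}
    (hμ : IsCanonicalForm s μ g) (hsymm : SymmetryCondition μ) : IsERSOfNonDegenerate ρ := by
  have := hμ.finite
  refine isERSOfNonDegenerate_of_moments (ae_map_exp_neg_mem_Ioo hμ.support)
    ((symmetryCondition_iff hμ.support).1 hsymm) ?_ h1 (hμ.moment_eq hext)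
  rw [Ne, Measure.map_eq_zero_iff (by fun_prop)]
  -- If `μ = 0`, then `g` vanishes identically, contradicting nonconstancy.
  rintro rfl
  obtain ⟨x₁, x₂, hne⟩ := hg.2
  exact hne (by simp [hμ.eq_integral])

theorem corollary4p1 (ρ : ℕ → ℝ) :
    (IsERSOfNonDegenerate ρ ↔
      ρ 1 = 0 ∧ ∃ g ∈ GStar, Extends g ρ ∧
        ∃ (s : ℝ → ℝ) (μ : Measure ℝ), IsCanonicalForm s μ g ∧ SymmetryCondition μ) ∧
    (IsERSOfNonDegenerate ρ →
      ∀ g ∈ GStar, Extends g ρ →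
        ∀ (s : ℝ → ℝ) (μ : Measure ℝ), IsCanonicalForm s μ g → SymmetryCondition μ) := by
  refine ⟨⟨fun h => ⟨h.exists_symmetric_measure.1, h.exists_canonicalForm⟩, ?_⟩,
    fun h g _ hext s μ hμ => h.symmetryCondition hext hμ⟩
  rintro ⟨h1, g, hg, hext, s, μ, hμ, hsymm⟩
  exact isERSOfNonDegenerate_of_canonicalForm h1 hg hext hμ hsymm
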